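/- \textbf{Conventions.} Let $R$ be a commutative ring of prime characteristic $p$. For $e\ge 0$, $F^e_*R$ denotes the additive group $R$ with the $R$-module structure $r\cdot F^e_*x=F^e_*(r^{p^e}x)$, and $R^\circ$ denotes the set of elements of $R$ lying in no minimal prime. An \emph{$F$-splitting} is an $R$-linear map $\varphi\colon F^e_*R\to R$ with $\varphi(F^e_*1)=1$. $R$ is \emph{strongly $F$-regular} if for every $d\in R^\circ$ there are $e>0$ and $\varphi\in\operatorname{Hom}_R(F^e_*R,R)$ with $\varphi(F^e_*d)=1$. For an ideal $\mathfrak a\subseteq R$ and a real number $t\ge 0$, an element $c\in R^\circ$ is a \emph{test element of $(R,\mathfrak a^t)$} if for every $d\in R^\circ$ there are $e>0$ and $\varphi\in\operatorname{Hom}_R(F^e_*R,R)$ with $c\in\varphi\bigl(F^e_*\,d\,\mathfrak a^{\lceil t(p^e-1)\rceil}\bigr)$, and the \emph{test ideal} is \[ \tau(\mathfrak a^t)=\sum_{e>0}\ \sum_{\varphi\in\operatorname{Hom}_R(F^e_*R,R)}\varphi\bigl(F^e_*\,c\,\mathfrak a^{\lceil t(p^e-1)\rceil}\bigr) \] for any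 test element $c$ of $(R,\mathfrak a^t)$; it does not depend on $c$. (If there is no test element, put $\tau(\mathfrak a^t)=0$.) For a $k$-algebra $R$ let $\mu\colon R\otimes_kR\to R$ be the multiplication map. The \emph{second diagonal Cartier algebra} $\mathscr D^{(2)}(R/k)$ is the graded ring whose piece of degree $e$ consists of the maps $\overline\varphi\colon F^e_*R\to R$ induced, via $\overline\varphi\circ F^e_*\mu=\mu\circ\varphi$, by the $R\otimes_kR$-linear maps $\varphi\colon F^e_*(R\otimes_kR)\to R\otimes_kR$ with $\varphi(F^e_*\ker\mu)\subseteq\ker\mu$. It is \emph{$F$-split} if for some $e>0$ its piece of degree $e$ contains an $F$-splitting of $R$. The ring $R$ is \emph{diagonally $F$-split over $k$} if for some $e>0$ there is an $F$-splitting $\varphi\colon F^e_*(R\otimes_kR)\to R\otimes_kR$ with $\varphi(F^e_*\ker\mu)\subseteq\ker\mu$. \textbf{Theorem A.} Let $k$ be a field of characteristic $p>0$ that is $F$-finite (that is, $F_*k$ is a finite-dimensional $k$-vector space), and let $R$ be a strongly $F$-regular $k$-algebra essentially of finite type. Suppose that $\mathscr D^{(2)}(R/k)$ is $F$-split; this holds,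 for example, if $R$ is diagonally $F$-split over $k$. Let $\mathfrak a\subseteq R$ be an ideal that is either zero or not contained in any minimal prime of $R$ (if $R$ is a domain, this is any ideal), and let $s,t>0$ be real numbers with $s+t\in\mathbb Z$. Then \[ \mathfrak a^{s+t}\subseteq\tau(\mathfrak a^{s-\epsilon})\,\tau(\mathfrak a^{t-\epsilon}) \qquad\text{for all }\epsilon\in(0,\min\{s,t\}]. \] -/

import Mathlib

open scoped TensorProduct

section FSingularities

variable {R : Type*} [CommRing R]

/-- An additive map `φ : R → R` viewed as a map `Fᵉ_* R → R` is `R`-linear. Here `Fᵉ_* R` is the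
additive group of `R` on which `r` acts as multiplication by `r ^ p ^ e`, so `R`-linearity reads
`φ (r ^ p ^ e * x) = r * φ x`. Thus the `φ` with this property form `Hom_R(Fᵉ_* R, R)`. -/
def IsFrobLinear (p e : ℕ) (φ : R →+ R) : Prop :=
  ∀ r x : R, φ (r ^ p ^ e * x) = r * φ x

/-- `φ` is an `F`-splitting `Fᵉ_* R → R`. -/
def IsFSplitting (p e : ℕ) (φ : R →+ R) : Prop :=
  IsFrobLinear p e φ ∧ φ 1 = 1

/-- `R°`: the elements of `R` that lie in no minimal prime. -/
def nonMinimal (R : Type*) [CommRing R] : Set R :=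
  {c | ∀ q ∈ minimalPrimes R, c ∉ q}

/-- `c` is a (big) test element of `R`. -/
def IsTestElement (p : ℕ) (c : R) : Prop :=
  c ∈ nonMinimal R ∧ ∀ d ∈ nonMinimal R,
    ∃ e > 0, ∃ φ : R →+ R, IsFrobLinear p e φ ∧ φ d = c

/-- `R` is strongly `F`-regular: `1` is a test element, i.e. for each `d ∈ R°` there are `e > 0` and
an `R`-linear map `Fᵉ_* R → R` that sends `Fᵉ_* d` to `1`. -/
def IsStronglyFRegular (p : ℕ) (R : Type*) [CommRing R] : Prop :=
  IsTestElement p (1 : R)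

/-- The ideal `𝔞 ^ ⌈t (pᵉ - 1)⌉`, for real `t ≥ 0`. -/
noncomputable def ceilPow (p : ℕ) (a : Ideal R) (t : ℝ) (e : ℕ) : Ideal R :=
  a ^ ⌈t * ((p : ℝ) ^ e - 1)⌉₊

/-- `c` is a test element of the pair `(R, 𝔞ᵗ)`. -/
def IsPairTestElement (p : ℕ) (a : Ideal R) (t : ℝ) (c : R) : Prop :=
  c ∈ nonMinimal R ∧ ∀ d ∈ nonMinimal R,
    ∃ e > 0, ∃ φ : R →+ R, IsFrobLinear p e φ ∧ ∃ x ∈ ceilPow p a t e, φ (d * x) = c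

/-- The sum of the ideals `φ(Fᵉ_* (c 𝔞 ^ ⌈t (pᵉ - 1)⌉))` over all `e > 0` and all
`φ ∈ Hom_R(Fᵉ_* R, R)`. -/
def testIdealOf (p : ℕ) (a : Ideal R) (t : ℝ) (c : R) : Ideal R :=
  Ideal.span {y | ∃ e > 0, ∃ φ : R →+ R, IsFrobLinear p e φ ∧ ∃ x ∈ ceilPow p a t e, φ (c * x) = y}

/-- The test ideal `τ(𝔞ᵗ)` of the pair `(R, 𝔞ᵗ)`. It is `testIdealOf p a t c` for any test element
`c` of the pair (`testIdeal_eq`); summing over all of them avoids a choice. -/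
def testIdeal (p : ℕ) (a : Ideal R) (t : ℝ) : Ideal R :=
  ⨆ (c : R) (_ : IsPairTestElement p a t c), testIdealOf p a t c

theorem IsFrobLinear.comp {p e d : ℕ} {φ ψ : R →+ R} (hφ : IsFrobLinear p e φ)
    (hψ : IsFrobLinear p d ψ) : IsFrobLinear p (e + d) (φ.comp ψ) := by
  intro r x
  simp only [AddMonoidHom.comp_apply]
  rw [pow_add, pow_mul, hψ, hφ]

theorem testIdealOf_le {p : ℕ} {a : Ideal R} {t : ℝ} {c c' : R}
    (hc : IsPairTestElement p a t c) (hc' : IsPairTestElement p a t c') :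
    testIdealOf p a t c' ≤ testIdealOf p a t c := by
  refine Ideal.span_le.2 ?_
  rintro y ⟨e', he', φ', hφ', x', hx', rfl⟩
  obtain ⟨e, he, φ, hφ, x, hx, hxc⟩ := hc'.2 c hc.1
  refine Ideal.subset_span ⟨e' + e, by omega, φ'.comp φ, hφ'.comp hφ, x * x' ^ p ^ e, ?_, ?_⟩
  · have h1 := Ideal.mul_mem_mul hx (Ideal.pow_mem_pow hx' (p ^ e))
    unfold ceilPow at *
    rw [← pow_mul, ← pow_add] at h1
    refine Ideal.pow_le_pow_right (Nat.ceil_le.2 ?_) h1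
    have hpe : (0 : ℝ) ≤ (p : ℝ) ^ e := by positivity
    have h2 := Nat.le_ceil (t * ((p : ℝ) ^ e - 1))
    have h3 := mul_le_mul_of_nonneg_right (Nat.le_ceil (t * ((p : ℝ) ^ e' - 1))) hpe
    push_cast
    rw [pow_add]
    nlinarith
  · have h4 : c * (x * x' ^ p ^ e) = x' ^ p ^ e * (c * x) := by ring
    rw [AddMonoidHom.comp_apply, h4, hφ, hxc, mul_comm]

theorem testIdeal_eq {p : ℕ} {a : Ideal R} {t : ℝ} {c : R}
    (hc : IsPairTestElement p a t c) : testIdeal p a t = testIdealOf p a t c :=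
  le_antisymm (iSup₂_le fun _ h => testIdealOf_le hc h)
    (le_iSup₂_of_le c hc le_rfl)

/-- A Cartier algebra on `R`: a graded subring of `⨁ₑ Hom_R(Fᵉ_* R, R)`, given by its graded pieces,
whose degree zero piece is all of `Hom_R(R, R)`. -/
structure CartierAlgebra (p : ℕ) (R : Type*) [CommRing R] where
  piece : ℕ → AddSubgroup (R →+ R)
  isFrobLinear : ∀ {e : ℕ} {φ : R →+ R}, φ ∈ piece e → IsFrobLinear p e φ
  mem_piece_zero : ∀ {φ : R →+ R}, IsFrobLinear p 0 φ → φ ∈ piece 0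
  comp_mem : ∀ {e d : ℕ} {φ ψ : R →+ R}, φ ∈ piece e → ψ ∈ piece d → φ.comp ψ ∈ piece (e + d)

/-- A Cartier algebra is `F`-split if it contains an `F`-splitting of some positive degree. -/
def CartierAlgebra.IsFSplit {p : ℕ} (D : CartierAlgebra p R) : Prop :=
  ∃ e > 0, ∃ φ ∈ D.piece e, IsFSplitting p e φ

/-- The Cartier algebra on `R` of the maps `φ` compatible with `I`, i.e. `φ(Fᵉ_* I) ⊆ I`. -/
def CartierAlgebra.compatible (p : ℕ) (I : Ideal R) : CartierAlgebra p R where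
  piece e :=
    { carrier := {φ | IsFrobLinear p e φ ∧ ∀ x ∈ I, φ x ∈ I}
      zero_mem' := ⟨fun r x => by simp, fun x _ => by simp⟩
      add_mem' := fun {φ ψ} hφ hψ =>
        ⟨fun r x => by simp [hφ.1 r x, hψ.1 r x, mul_add],
          fun x hx => I.add_mem (hφ.2 x hx) (hψ.2 x hx)⟩
      neg_mem' := fun {φ} hφ =>
        ⟨fun r x => by simp [hφ.1 r x], fun x hx => I.neg_mem (hφ.2 x hx)⟩ }
  isFrobLinear h := h.1
  mem_piece_zero {φ} h := ⟨h, fun x hx => by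
    have h1 := h x 1
    rw [pow_zero, pow_one, mul_one] at h1
    rw [h1]
    exact I.mul_mem_right _ hx⟩
  comp_mem hφ hψ := ⟨hφ.1.comp hψ.1, fun x hx => hφ.2 _ (hψ.2 x hx)⟩

/-- For a surjective ring map `π : S → R`, which identifies `S ⧸ ker π` with `R`, the restriction to
`R` of the Cartier algebra on `S` of maps compatible with `ker π`: it consists of the maps induced
on `R` by maps `φ` on `S` compatible with `ker π`. -/
def CartierAlgebra.restrict (p : ℕ) {S : Type*} [CommRing S] (π : S →+* R)
    (hπ : Function.Surjective π) : CartierAlgebra p R where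
  piece e :=
    { carrier := {ψ | ∃ φ ∈ (CartierAlgebra.compatible p (RingHom.ker π)).piece e,
        ∀ x, ψ (π x) = π (φ x)}
      zero_mem' := ⟨0, zero_mem _, fun x => by simp⟩
      add_mem' := by
        rintro _ _ ⟨φ, hφ, h⟩ ⟨φ', hφ', h'⟩
        exact ⟨φ + φ', add_mem hφ hφ', fun x => by simp [h, h']⟩
      neg_mem' := by
        rintro _ ⟨φ, hφ, h⟩
        exact ⟨-φ, neg_mem hφ, fun x => by simp [h]⟩ }
  isFrobLinear := by
    rintro e ψ ⟨φ, hφ, h⟩ r x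
    obtain ⟨r, rfl⟩ := hπ r
    obtain ⟨x, rfl⟩ := hπ x
    rw [← map_pow, ← map_mul, h, h, hφ.1, map_mul]
  mem_piece_zero := by
    intro ψ hψ
    obtain ⟨s, hs⟩ := hπ (ψ 1)
    refine ⟨AddMonoidHom.mulLeft s, CartierAlgebra.mem_piece_zero _ fun r x => ?_, fun x => ?_⟩
    · simp only [pow_zero, pow_one, AddMonoidHom.coe_mulLeft]
      ring
    · have h1 := hψ (π x) 1
      rw [pow_zero, pow_one, mul_one] at h1
      rw [h1, AddMonoidHom.coe_mulLeft, map_mul, hs, mul_comm]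
  comp_mem := by
    rintro e d _ _ ⟨φ, hφ, h⟩ ⟨φ', hφ', h'⟩
    exact ⟨φ.comp φ', CartierAlgebra.comp_mem _ hφ hφ', fun x => by simp [h, h']⟩

end FSingularities

section Diagonal

variable (p : ℕ) (k R : Type*) [CommRing k] [CommRing R] [Algebra k R]

/-- The multiplication map `μ : R ⊗ R → R`, `x ⊗ y ↦ x y`. -/
def diagMul : R ⊗[k] R →+* R :=
  (Algebra.TensorProduct.lmul' k : R ⊗[k] R →ₐ[k] R).toRingHom

theorem diagMul_surjective : Function.Surjective (diagMul k R) := fun x =>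
  ⟨x ⊗ₜ 1, by simp [diagMul]⟩

/-- `R` is diagonally `F`-split over `k`: `R ⊗ R` is `F`-split compatibly with `ker μ`. -/
def IsDiagonallyFSplit : Prop :=
  (CartierAlgebra.compatible p (RingHom.ker (diagMul k R))).IsFSplit

/-- The second diagonal Cartier algebra `𝒟⁽²⁾(R/k)`. -/
def secondDiagonalCartierAlgebra : CartierAlgebra p R :=
  CartierAlgebra.restrict p (diagMul k R) (diagMul_surjective k R)

end Diagonal

open scoped TensorProduct

/-! ### Test ideals of strongly `F`-regular rings. -/

section TestIdeal

variable {R : Type*} [CommRing R]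

/-! Lift an `F`-splitting `ψ` in the second diagonal Cartier algebra to `φ` on `R ⊗ R`. For `x ∈ 𝔞ⁿ`
one has `x = ψ(x^{pᵉ})`, and for large `e` the element `x^{pᵉ}` is a sum of products `u v = μ(u ⊗
v)` with `u ∈ 𝔞^A`, `v ∈ 𝔞^B`, where `A ≥ (s - ε) pᵉ` and `B ≥ (t - ε) pᵉ`. Hence `x` is a sum of
terms `μ(φ(u ⊗ v))`.

In a `k`-basis of one factor, the coordinates of `φ` are Frobenius-linear maps on the other factor.
By strong `F`-regularity these send `u` and `v` into the respective test ideals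
(`IsStronglyFRegular.apply_mem_testIdeal`). So `φ(u ⊗ v)` lies in `(τ ⊗ R) ∩ (R ⊗ τ')`, which `μ`
maps into `τ τ'` (`diagMul_mem_mul`). -/

theorem pow_mem_nonMinimal {b : R} (hb : b ∈ nonMinimal R) (m : ℕ) : b ^ m ∈ nonMinimal R :=
  fun q hq h => hb q hq (hq.1.1.mem_of_pow_mem m h)

/-- Prime avoidance: an ideal contained in no minimal prime meets `R°`. -/
theorem exists_mem_nonMinimal [IsNoetherianRing R] {a : Ideal R}
    (ha : ∀ q ∈ minimalPrimes R, ¬ a ≤ q) : ∃ b ∈ a, b ∈ nonMinimal R := by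
  by_contra! h
  have h1 : (a : Set R) ⊆ ⋃ q ∈ minimalPrimes R, (q : Set R) := by
    intro b hb
    have h2 := h b hb
    simp only [nonMinimal, Set.mem_ofPred_eq, not_forall, not_not] at h2
    obtain ⟨q, hq, hbq⟩ := h2
    exact Set.mem_biUnion hq hbq
  rw [Ideal.subset_union_prime_finite (minimalPrimes.finite_of_isNoetherianRing R) ⊥ ⊥
    (fun q hq _ _ => hq.1.1)] at h1
  obtain ⟨q, hq, hle⟩ := h1
  exact ha q hq hle

/-- In a strongly `F`-regular ring, each `b ∈ 𝔞 ∩ R°` has a power that is a test element of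
`(R, 𝔞ᵗ)`. -/
theorem IsStronglyFRegular.isPairTestElement_pow {p : ℕ} (hR : IsStronglyFRegular p R)
    {a : Ideal R} {b : R} (hba : b ∈ a) (hb : b ∈ nonMinimal R) {t : ℝ} (ht : 0 ≤ t) :
    IsPairTestElement p a t (b ^ ⌈t⌉₊) := by
  refine ⟨pow_mem_nonMinimal hb _, fun d hd => ?_⟩
  obtain ⟨e, he, φ, hφ, hφd⟩ := hR.2 d hd
  refine ⟨e, he, φ, hφ, (b ^ ⌈t⌉₊) ^ p ^ e, ?_, ?_⟩
  · rw [← pow_mul]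
    refine Ideal.pow_le_pow_right (Nat.ceil_le.2 ?_) (Ideal.pow_mem_pow hba _)
    push_cast
    have h1 := mul_le_mul_of_nonneg_right (Nat.le_ceil t) (by positivity : (0 : ℝ) ≤ (p : ℝ) ^ e)
    linarith
  · rw [mul_comm, hφ, hφd, mul_one]

/-- In a strongly `F`-regular ring, every map `Fᵉ_* R → R` sends `𝔞 ^ m` into `τ(𝔞ᵗ)` once
`t pᵉ ≤ m`. -/
theorem IsStronglyFRegular.apply_mem_testIdeal [IsNoetherianRing R] {p : ℕ}
    (hR : IsStronglyFRegular p R) {a : Ideal R} (ha : ∀ q ∈ minimalPrimes R, ¬ a ≤ q)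
    {t : ℝ} (ht : 0 ≤ t) {e m : ℕ} (hm : t * (p : ℝ) ^ e ≤ m) {φ : R →+ R}
    (hφ : IsFrobLinear p e φ) {x : R} (hx : x ∈ a ^ m) : φ x ∈ testIdeal p a t := by
  obtain ⟨b, hba, hb⟩ := exists_mem_nonMinimal ha
  have hc := hR.isPairTestElement_pow hba hb ht
  obtain ⟨d, hd, ψ, hψ, hψc⟩ := hR.2 _ hc.1
  rw [testIdeal_eq hc]
  -- Since `ψ c = 1`, precomposing with `ψ` absorbs the test element: `φ(ψ(c x^{p^d})) = φ(x)`. It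
  -- also makes the degree positive when `e = 0`.
  refine Ideal.subset_span ⟨e + d, by omega, φ.comp ψ, hφ.comp hψ, x ^ p ^ d, ?_, ?_⟩
  · have h1 := Ideal.pow_mem_pow hx (p ^ d)
    rw [← pow_mul] at h1
    refine Ideal.pow_le_pow_right (Nat.ceil_le.2 ?_) h1
    have h2 := mul_le_mul_of_nonneg_right hm (by positivity : (0 : ℝ) ≤ (p : ℝ) ^ d)
    push_cast
    rw [pow_add]
    linarith
  · rw [AddMonoidHom.comp_apply, mul_comm, hψ, hψc, mul_one]

end TestIdeal

/-! ### `F`-split Cartier algebras. -/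

section CartierAlgebra

variable {p : ℕ} {R : Type*} [CommRing R]

/-- An `F`-split Cartier algebra has `F`-splittings of arbitrarily large degree. -/
theorem CartierAlgebra.IsFSplit.exists_ge {D : CartierAlgebra p R} (hD : D.IsFSplit) (N : ℕ) :
    ∃ e ≥ N, ∃ φ ∈ D.piece e, IsFSplitting p e φ := by
  obtain ⟨e, he, φ, hφ, hφs⟩ := hD
  induction N with
  | zero => exact ⟨e, Nat.zero_le _, φ, hφ, hφs⟩
  | succ N ih =>
    obtain ⟨d, hd, ψ, hψ, hψs⟩ := ih
    refine ⟨e + d, by omega, φ.comp ψ, D.comp_mem hφ hψ, hφs.1.comp hψs.1, ?_⟩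
    rw [AddMonoidHom.comp_apply, hψs.2, hφs.2]

/-- A compatible `F`-splitting upstairs induces one downstairs. -/
theorem CartierAlgebra.IsFSplit.restrict {S : Type*} [CommRing S] {π : S →+* R}
    (hπ : Function.Surjective π)
    (h : (CartierAlgebra.compatible p (RingHom.ker π)).IsFSplit) :
    (CartierAlgebra.restrict p π hπ).IsFSplit := by
  obtain ⟨e, he, φ, hφ, hφs⟩ := h
  let g : {g : S →+ R // (π : S →+ R).ker ≤ g.ker} := ⟨(π : S →+ R).comp φ, fun x hx => hφ.2 x hx⟩
  let ψ : R →+ R := (π : S →+ R).liftOfSurjective hπ g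
  have hψ : ∀ x, ψ (π x) = π (φ x) :=
    (π : S →+ R).liftOfRightInverse_comp_apply _ (Function.rightInverse_surjInv hπ) g
  have hmem : ψ ∈ (CartierAlgebra.restrict p π hπ).piece e := ⟨φ, hφ, hψ⟩
  refine ⟨e, he, ψ, hmem, CartierAlgebra.isFrobLinear _ hmem, ?_⟩
  rw [← map_one π, hψ, hφs.2]

end CartierAlgebra

/-! ### Frobenius-linear maps on `R ⊗ R`. -/

section Diagonal

variable {p : ℕ} {k R : Type*} [Field k] [CommRing R] [Algebra k R]

/-- If every map `Fᵉ_* R → R` sends `u` into `I`, then every map `Fᵉ_* (R ⊗ R) → R ⊗ R` sends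
`u ⊗ y` into the extension of `I` along the left factor. -/
theorem IsFrobLinear.apply_tmul_mem_map_includeLeft {e : ℕ} {φ : R ⊗[k] R →+ R ⊗[k] R}
    (hφ : IsFrobLinear p e φ) {I : Ideal R} {u : R}
    (hu : ∀ ψ : R →+ R, IsFrobLinear p e ψ → ψ u ∈ I) (y : R) :
    φ (u ⊗ₜ y) ∈ I.map (Algebra.TensorProduct.includeLeftRingHom : R →+* R ⊗[k] R) := by
  -- A `k`-basis of the right factor is a basis of `R ⊗ R` over the left factor, so it suffices to
  -- put each coordinate in `I`.
  let b := Algebra.TensorProduct.basis R (Module.Basis.ofVectorSpace k R)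
  rw [← b.linearCombination_repr (φ (u ⊗ₜ y)), Finsupp.linearCombination_apply]
  refine Ideal.sum_mem _ fun j _ => ?_
  let ψ : R →+ R := ((b.coord j).toAddMonoidHom.comp φ).comp
    ((TensorProduct.mk k R R).flip y).toAddMonoidHom
  have hψ : IsFrobLinear p e ψ := by
    intro r x
    have h1 := hφ (r ⊗ₜ 1) (x ⊗ₜ y)
    rw [Algebra.TensorProduct.tmul_pow, one_pow, Algebra.TensorProduct.tmul_mul_tmul,
      one_mul] at h1
    have h2 : (r ⊗ₜ[k] (1 : R)) * φ (x ⊗ₜ y) = r • φ (x ⊗ₜ y) := by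
      rw [Algebra.smul_def]; rfl
    change b.coord j (φ ((r ^ p ^ e * x) ⊗ₜ y)) = r * b.coord j (φ (x ⊗ₜ y))
    rw [h1, h2, map_smul, smul_eq_mul]
  have h3 : b.repr (φ (u ⊗ₜ y)) j ∈ I := hu ψ hψ
  change b.repr (φ (u ⊗ₜ y)) j • b j ∈ _
  rw [Algebra.smul_def]
  exact Ideal.mul_mem_right _ _ (Ideal.mem_map_of_mem _ h3)

/-- Applied to the swap of the two tensor factors, this reduces the right-hand case to the left-hand
one. -/
theorem IsFrobLinear.conj {S T : Type*} [CommRing S] [CommRing T] {e : ℕ} {φ : S →+ S}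
    (hφ : IsFrobLinear p e φ) (σ : S ≃+* T) :
    IsFrobLinear p e (((σ : S →+ T).comp φ).comp (σ.symm : T →+ S)) := by
  intro r x
  simp [hφ (σ.symm r) (σ.symm x)]

/-- If every map `Fᵉ_* R → R` sends `v` into `J`, then every map `Fᵉ_* (R ⊗ R) → R ⊗ R` sends
`x ⊗ v` into the extension of `J` along the right factor. -/
theorem IsFrobLinear.apply_tmul_mem_map_includeRight {e : ℕ} {φ : R ⊗[k] R →+ R ⊗[k] R}
    (hφ : IsFrobLinear p e φ) {J : Ideal R} {v : R}
    (hv : ∀ ψ : R →+ R, IsFrobLinear p e ψ → ψ v ∈ J) (x : R) :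
    φ (x ⊗ₜ v) ∈ J.map (Algebra.TensorProduct.includeRight : R →ₐ[k] R ⊗[k] R).toRingHom := by
  let σ : R ⊗[k] R ≃+* R ⊗[k] R := (Algebra.TensorProduct.comm k R R).toRingEquiv
  have h1 := (hφ.conj σ).apply_tmul_mem_map_includeLeft hv x
  have h2 := Ideal.mem_map_of_mem (σ.symm : R ⊗[k] R →+* R ⊗[k] R) h1
  rw [Ideal.map_map] at h2
  have h3 : (σ.symm : R ⊗[k] R →+* R ⊗[k] R).comp Algebra.TensorProduct.includeLeftRingHom =
      (Algebra.TensorProduct.includeRight : R →ₐ[k] R ⊗[k] R).toRingHom := by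
    ext r
    rfl
  rw [h3] at h2
  have h4 : (σ.symm : R ⊗[k] R →+* R ⊗[k] R)
      ((((σ : R ⊗[k] R →+ R ⊗[k] R).comp φ).comp (σ.symm : R ⊗[k] R →+ R ⊗[k] R)) (v ⊗ₜ x)) =
      φ (x ⊗ₜ v) := by
    change σ.symm (σ (φ (x ⊗ₜ v))) = _
    rw [σ.symm_apply_apply]
  rwa [h4] at h2

/-- Over a field, the multiplication map sends `(I ⊗ R) ∩ (R ⊗ J)` into `I * J`. -/
theorem diagMul_mem_mul {I J : Ideal R} {z : R ⊗[k] R}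
    (hI : z ∈ I.map (Algebra.TensorProduct.includeLeftRingHom : R →+* R ⊗[k] R))
    (hJ : z ∈ J.map (Algebra.TensorProduct.includeRight : R →ₐ[k] R ⊗[k] R).toRingHom) :
    diagMul k R z ∈ I * J := by
  -- A `k`-linear projection `g` of `R` onto `J` exists because `k` is a field. Then `id ⊗ g` fixes
  -- `R ⊗ J` and carries `I ⊗ R` into `I ⊗ J`.
  obtain ⟨f, hf⟩ := (J.restrictScalars k).subtype.exists_leftInverse_of_injective
    (Submodule.ker_subtype _)
  let g : R →ₗ[k] R := (J.restrictScalars k).subtype ∘ₗ f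
  have hgJ : ∀ y, g y ∈ J := fun y => (f y).2
  have hg : ∀ y ∈ J, g y = y := fun y hy => congrArg Subtype.val (LinearMap.congr_fun hf ⟨y, hy⟩)
  have hz : g.lTensor R z = z := by
    -- `id ⊗ g` is only additive and `k`-linear, so the induction runs over sums of multiples of
    -- generators rather than over the `R ⊗ R`-action.
    refine Submodule.closure_induction (p := fun w _ => g.lTensor R w = w) (map_zero _)
      (fun x y _ _ hx hy => by rw [map_add, hx, hy]) ?_ hJ
    rintro w _ ⟨j, hj, rfl⟩
    induction w with
    | zero => rw [zero_smul, map_zero]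
    | add w w' hw hw' => rw [add_smul, map_add, hw, hw']
    | tmul x y =>
      have h1 : (x ⊗ₜ[k] y) • (Algebra.TensorProduct.includeRight : R →ₐ[k] R ⊗[k] R).toRingHom j =
          x ⊗ₜ (y * j) := by simp
      rw [h1, LinearMap.lTensor_tmul, hg _ (J.mul_mem_left _ hj)]
  rw [← hz]
  refine Submodule.closure_induction (p := fun w _ => diagMul k R (g.lTensor R w) ∈ I * J)
    (by simp) (fun x y _ _ hx hy => by rw [map_add, map_add]; exact add_mem hx hy) ?_ hI
  rintro w _ ⟨i, hi, rfl⟩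
  induction w with
  | zero => simp
  | add w w' hw hw' => rw [add_smul, map_add, map_add]; exact add_mem hw hw'
  | tmul x y =>
    have h1 : (x ⊗ₜ[k] y) • (Algebra.TensorProduct.includeLeftRingHom : R →+* R ⊗[k] R) i =
        (x * i) ⊗ₜ y := by simp
    have h2 : diagMul k R ((x * i) ⊗ₜ g y) = x * i * g y := by simp [diagMul]
    rw [h1, LinearMap.lTensor_tmul, h2]
    exact Ideal.mul_mem_mul (I.mul_mem_left _ hi) (hgJ y)

end Diagonal

theorem theoremA (p : ℕ) [Fact p.Prime] {k R : Type*} [Field k] [CharP k p]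
    (hk : (frobenius k p).Finite) [CommRing R] [Algebra k R] [Algebra.EssFiniteType k R]
    (hR : IsStronglyFRegular p R) :
    (IsDiagonallyFSplit p k R → (secondDiagonalCartierAlgebra p k R).IsFSplit) ∧
    ((secondDiagonalCartierAlgebra p k R).IsFSplit →
      ∀ a : Ideal R, (a = ⊥ ∨ ∀ q ∈ minimalPrimes R, ¬ a ≤ q) →
      ∀ s t : ℝ, 0 < s → 0 < t → ∀ n : ℕ, s + t = n →
      ∀ ε : ℝ, 0 < ε → ε ≤ min s t →
        a ^ n ≤ testIdeal p a (s - ε) * testIdeal p a (t - ε)) := by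
  refine ⟨fun h => h.restrict (diagMul_surjective k R), ?_⟩
  intro hD a ha s t hs ht n hn ε hε hεst x hx
  rcases ha with rfl | ha
  -- The zeroth power of the zero ideal would be all of `R`; positivity of `s + t` excludes this.
  · have hn0 : n ≠ 0 := by
      rintro rfl
      norm_num at hn
      linarith
    rw [← Ideal.zero_eq_bot, zero_pow hn0, Ideal.zero_eq_bot, Ideal.mem_bot] at hx
    rw [hx]
    exact zero_mem _
  have : IsNoetherianRing R := Algebra.EssFiniteType.isNoetherianRing k R
  have hs' : 0 ≤ s - ε := by linarith [min_le_left s t]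
  have ht' : 0 ≤ t - ε := by linarith [min_le_right s t]
  have hp1 : (1 : ℝ) < p := by exact_mod_cast (Fact.out : p.Prime).one_lt
  obtain ⟨N, hN⟩ := pow_unbounded_of_one_lt (1 / ε) hp1
  obtain ⟨e, he, ψ, ⟨φ, hφ, hφψ⟩, hψ⟩ := hD.exists_ge N
  have hεe : 1 ≤ ε * (p : ℝ) ^ e := by
    rw [div_lt_iff₀ hε] at hN
    have h1 := mul_le_mul_of_nonneg_left (pow_le_pow_right₀ hp1.le he) hε.le
    linarith
  set A := ⌈(s - ε) * (p : ℝ) ^ e⌉₊ with hA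
  set B := ⌈(t - ε) * (p : ℝ) ^ e⌉₊ with hB
  -- The two ceilings cost less than `2`, and `2 ε pᵉ ≥ 2` pays for them.
  have hAB : A + B ≤ n * p ^ e := by
    have hA' := Nat.ceil_lt_add_one (by positivity : 0 ≤ (s - ε) * (p : ℝ) ^ e)
    have hB' := Nat.ceil_lt_add_one (by positivity : 0 ≤ (t - ε) * (p : ℝ) ^ e)
    have h1 : ((A + B : ℕ) : ℝ) ≤ ((n * p ^ e : ℕ) : ℝ) := by
      push_cast
      rw [← hn]
      linarith
    exact_mod_cast h1
  have hxq : x ^ p ^ e ∈ a ^ A * a ^ B := by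
    rw [← pow_add]
    refine Ideal.pow_le_pow_right hAB ?_
    rw [pow_mul]
    exact Ideal.pow_mem_pow hx _
  have hψx : ψ (x ^ p ^ e) = x := by
    have h1 := hψ.1 x 1
    rwa [hψ.2, mul_one, mul_one] at h1
  rw [← hψx]
  refine Submodule.mul_induction_on hxq (fun u hu v hv => ?_) fun y z hy hz => ?_
  · have huv : u * v = diagMul k R (u ⊗ₜ v) := by simp [diagMul]
    rw [huv, hφψ]
    exact diagMul_mem_mul
      (hφ.1.apply_tmul_mem_map_includeLeft
        (fun χ hχ => hR.apply_mem_testIdeal ha hs' (Nat.le_ceil _) hχ hu) v)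
      (hφ.1.apply_tmul_mem_map_includeRight
        (fun χ hχ => hR.apply_mem_testIdeal ha ht' (Nat.le_ceil _) hχ hv) u)
  · rw [map_add]
    exact add_mem hy hz
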